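/- Conventions. All double categories are pseudo: a double category $\mathbb{D}$ has a category $\mathbb{D}_0$ of objects and arrows, a category $\mathbb{D}_1$ of proarrows and cells, source and target functors $\mathbb{D}_1 \rightrightarrows \mathbb{D}_0$, and an external composition $\odot$ and external units, associative and unital up to coherent globular isomorphism. A lax double functor $\mathbb{F}:\mathbb{D}\to\mathbb{E}$ consists of functors $\mathbb{F}_0:\mathbb{D}_0\to\mathbb{E}_0$ and $\mathbb{F}_1:\mathbb{D}_1\to\mathbb{E}_1$ that commute strictly with source and target, with natural globular laxators $\mathbb{F}m\odot\mathbb{F}n\to\mathbb{F}(m\odot n)$ and unitors $\mathrm{id}_{\mathbb{F}a}\to\mathbb{F}(\mathrm{id}_a)$ satisfying the usual associativity and unit laws; it is pseudo if all laxators and unitors are isomorphisms. A double category $\mathbb{D}$ is cocartesian if $\mathbb{D}_0$ and $\mathbb{D}_1$ have finite coproducts, source and target preserve them, and the canonical comparison cells $(m\odot n)+(m'\odot n')\to(m+m')\odot(n+n')$, $\mathrm{id}_x+\mathrm{id}_{x'}\to\mathrm{id}_{x+x'}$, $0\to 0\odot 0$ and $0\to\mathrm{id}_0$ (for coproducts chosen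 strictly compatibly with source and target) are isomorphisms. A lax double functor between cocartesian double categories is cocartesian if both $\mathbb{F}_0$ and $\mathbb{F}_1$ preserve finite coproducts. For a functor $L:\mathsf{A}\to\mathsf{X}$ into a category with pushouts, $\mathbb{C}\mathsf{sp}(L,\mathsf{X})$ denotes the double category of $L$-structured cospans: objects and arrows are those of $\mathsf{A}$; proarrows from $a$ to $b$ are cospans $L(a)\xrightarrow{\ell}x\xleftarrow{r}L(b)$ in $\mathsf{X}$; cells from $(a,\ell,x,r,b)$ to $(a',\ell',x',r',b')$ are triples $(f:a\to a',\,h:x\to x',\,g:b\to b')$ with $h\ell=\ell'L(f)$ and $hr=r'L(g)$; external composition is by pushout in $\mathsf{X}$, and the external unit on $a$ is $L(a)=L(a)=L(a)$. Theorem. Let $L:\mathsf{A}\to\mathsf{X}$, $L':\mathsf{A}'\to\mathsf{X}'$, $F_0:\mathsf{A}\to\mathsf{A}'$ and $F_1:\mathsf{X}\to\mathsf{X}'$ be functors, where $\mathsf{X}$ and $\mathsf{X}'$ have pushouts, and let $\alpha:L'\circ F_0\Rightarrow F_1\circ L$ be a natural transformation. Then there is a lax double functor $\mathbb{F}:\mathbb{C}\mathsf{sp}(L,\mathsf{X})\to\mathbb{C}\mathsf{sp}(L',\mathsf{X}')$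 that has underlying functor $\mathbb{F}_0=F_0$, acts on proarrows by $$\bigl(L(a)\xrightarrow{\ell}x\xleftarrow{r}L(b)\bigr)\ \mapsto\ \bigl(L'(F_0(a))\xrightarrow{F_1(\ell)\circ\alpha_a}F_1(x)\xleftarrow{F_1(r)\circ\alpha_b}L'(F_0(b))\bigr)$$ and on cells by $(f,h,g)\mapsto(F_0(f),F_1(h),F_0(g))$. For proarrows $m$ from $a$ to $b$ with apex $x$ and $n$ from $b$ to $c$ with apex $y$, its laxator $\mathbb{F}m\odot\mathbb{F}n\to\mathbb{F}(m\odot n)$ has as apex map the map $F_1(x)+_{L'(F_0(b))}F_1(y)\to F_1(x+_{L(b)}y)$ whose composites with the two coprojections are $F_1(\iota_x)$ and $F_1(\iota_y)$; its unitor at $a$ has apex map $\alpha_a$. This $\mathbb{F}$ satisfies the following. 1. If $F_1$ preserves pushouts and $\alpha$ is a natural isomorphism, then $\mathbb{F}$ is pseudo. 2. Suppose further that $\mathsf{A},\mathsf{X},\mathsf{A}',\mathsf{X}'$ have finite coproducts and that $L$ and $L'$ preserve them. Then both $\mathbb{C}\mathsf{sp}(L,\mathsf{X})$ and $\mathbb{C}\mathsf{sp}(L',\mathsf{X}')$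 are cocartesian, and $\mathbb{F}$ is cocartesian if and only if $F_0$ and $F_1$ both preserve finite coproducts. In particular, if $F_0$ preserves finite coproducts, $F_1$ preserves finite colimits and $\alpha$ is a natural isomorphism, then $\mathbb{F}$ is a cocartesian pseudo double functor. -/

import Mathlib

open CategoryTheory CategoryTheory.Limits

universe u₀ v₀ u₁ v₁ u₀' v₀' u₁' v₁' uA vA uX vX uA' vA' uX' vX'

/-! ### Double categories -/

/-- The type of all proarrows, each with its source and target, of a family `P` of proarrows
indexed by source and target. -/
structure TotalPro {O : Type u₀} (P : O → O → Type u₁) where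
  src : O
  tgt : O
  pro : P src tgt

/-- A proarrow `a ⇸ b`, regarded as an object of the category of proarrows. -/
abbrev TotalPro.of {O : Type u₀} {P : O → O → Type u₁} {a b : O} (m : P a b) : TotalPro P :=
  ⟨a, b, m⟩

set_option linter.checkUnivs false in
/-- A (pseudo) double category: a pseudocategory in the 2-category of categories. It consists of
a category `Obj` of objects and arrows, a category `TotalPro Pro` of proarrows and cells, source
and target functors, an external composition functor on the pullback `D₁ ×_{D₀} D₁` and an
external unit functor, with globular associator and unitors that satisfy the pentagon and triangle
identities. External composition is written in diagrammatic order. An object of the pullback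
`D₁ ×_{D₀} D₁` is a pair `m : Pro a b`, `n : Pro b c`; a morphism in it is a pair of cells `φ`, `ψ`
with `tgtMap φ = srcMap ψ`. -/
structure DoubleCategory where
  /-- objects -/
  Obj : Type u₀
  /-- arrows -/
  [category₀ : Category.{v₀} Obj]
  /-- proarrows with given source and target -/
  Pro : Obj → Obj → Type u₁
  /-- cells -/
  [category₁ : Category.{v₁} (TotalPro Pro)]
  /-- source functor on cells -/
  srcMap {M N : TotalPro Pro} (φ : M ⟶ N) : M.src ⟶ N.src
  srcMap_id (M : TotalPro Pro) : srcMap (𝟙 M) = 𝟙 M.src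
  srcMap_comp {M N P : TotalPro Pro} (φ : M ⟶ N) (ψ : N ⟶ P) :
    srcMap (φ ≫ ψ) = srcMap φ ≫ srcMap ψ
  /-- target functor on cells -/
  tgtMap {M N : TotalPro Pro} (φ : M ⟶ N) : M.tgt ⟶ N.tgt
  tgtMap_id (M : TotalPro Pro) : tgtMap (𝟙 M) = 𝟙 M.tgt
  tgtMap_comp {M N P : TotalPro Pro} (φ : M ⟶ N) (ψ : N ⟶ P) :
    tgtMap (φ ≫ ψ) = tgtMap φ ≫ tgtMap ψ
  /-- external composition of proarrows -/
  comp {a b c : Obj} (m : Pro a b) (n : Pro b c) : Pro a c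
  /-- external composition of cells -/
  compMap {a b c a' b' c' : Obj} {m : Pro a b} {n : Pro b c} {m' : Pro a' b'} {n' : Pro b' c'}
    (φ : TotalPro.of m ⟶ TotalPro.of m') (ψ : TotalPro.of n ⟶ TotalPro.of n')
    (h : tgtMap φ = srcMap ψ) : TotalPro.of (comp m n) ⟶ TotalPro.of (comp m' n')
  srcMap_compMap {a b c a' b' c' : Obj} {m : Pro a b} {n : Pro b c} {m' : Pro a' b'}
    {n' : Pro b' c'} (φ : TotalPro.of m ⟶ TotalPro.of m') (ψ : TotalPro.of n ⟶ TotalPro.of n')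
    (h : tgtMap φ = srcMap ψ) : srcMap (compMap φ ψ h) = srcMap φ
  tgtMap_compMap {a b c a' b' c' : Obj} {m : Pro a b} {n : Pro b c} {m' : Pro a' b'}
    {n' : Pro b' c'} (φ : TotalPro.of m ⟶ TotalPro.of m') (ψ : TotalPro.of n ⟶ TotalPro.of n')
    (h : tgtMap φ = srcMap ψ) : tgtMap (compMap φ ψ h) = tgtMap ψ
  compMap_id {a b c : Obj} (m : Pro a b) (n : Pro b c) :
    compMap (𝟙 (TotalPro.of m)) (𝟙 (TotalPro.of n))
      ((tgtMap_id (TotalPro.of m)).trans (srcMap_id (TotalPro.of n)).symm) =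
      𝟙 (TotalPro.of (comp m n))
  compMap_comp {a b c a' b' c' a'' b'' c'' : Obj} {m : Pro a b} {n : Pro b c}
    {m' : Pro a' b'} {n' : Pro b' c'} {m'' : Pro a'' b''} {n'' : Pro b'' c''}
    (φ : TotalPro.of m ⟶ TotalPro.of m') (ψ : TotalPro.of n ⟶ TotalPro.of n')
    (h : tgtMap φ = srcMap ψ)
    (φ' : TotalPro.of m' ⟶ TotalPro.of m'') (ψ' : TotalPro.of n' ⟶ TotalPro.of n'')
    (h' : tgtMap φ' = srcMap ψ') :
    compMap (φ ≫ φ') (ψ ≫ ψ') (by rw [tgtMap_comp, srcMap_comp, h, h']) =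
      compMap φ ψ h ≫ compMap φ' ψ' h'
  /-- external unit proarrows -/
  unit (a : Obj) : Pro a a
  /-- external unit cells -/
  unitMap {a b : Obj} (f : a ⟶ b) : TotalPro.of (unit a) ⟶ TotalPro.of (unit b)
  srcMap_unitMap {a b : Obj} (f : a ⟶ b) : srcMap (unitMap f) = f
  tgtMap_unitMap {a b : Obj} (f : a ⟶ b) : tgtMap (unitMap f) = f
  unitMap_id (a : Obj) : unitMap (𝟙 a) = 𝟙 (TotalPro.of (unit a))
  unitMap_comp {a b c : Obj} (f : a ⟶ b) (g : b ⟶ c) :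
    unitMap (f ≫ g) = unitMap f ≫ unitMap g
  /-- associator -/
  assoc {a b c d : Obj} (m : Pro a b) (n : Pro b c) (p : Pro c d) :
    TotalPro.of (comp (comp m n) p) ≅ TotalPro.of (comp m (comp n p))
  srcMap_assoc {a b c d : Obj} (m : Pro a b) (n : Pro b c) (p : Pro c d) :
    srcMap (assoc m n p).hom = 𝟙 a
  tgtMap_assoc {a b c d : Obj} (m : Pro a b) (n : Pro b c) (p : Pro c d) :
    tgtMap (assoc m n p).hom = 𝟙 d
  assoc_naturality {a b c d a' b' c' d' : Obj} {m : Pro a b} {n : Pro b c} {p : Pro c d}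
    {m' : Pro a' b'} {n' : Pro b' c'} {p' : Pro c' d'}
    (φ : TotalPro.of m ⟶ TotalPro.of m') (ψ : TotalPro.of n ⟶ TotalPro.of n')
    (χ : TotalPro.of p ⟶ TotalPro.of p') (h : tgtMap φ = srcMap ψ) (k : tgtMap ψ = srcMap χ) :
    compMap (compMap φ ψ h) χ ((tgtMap_compMap φ ψ h).trans k) ≫ (assoc m' n' p').hom =
      (assoc m n p).hom ≫ compMap φ (compMap ψ χ k) (h.trans (srcMap_compMap ψ χ k).symm)
  /-- left unitor -/
  leftUnitor {a b : Obj} (m : Pro a b) : TotalPro.of (comp (unit a) m) ≅ TotalPro.of m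
  srcMap_leftUnitor {a b : Obj} (m : Pro a b) : srcMap (leftUnitor m).hom = 𝟙 a
  tgtMap_leftUnitor {a b : Obj} (m : Pro a b) : tgtMap (leftUnitor m).hom = 𝟙 b
  leftUnitor_naturality {a b a' b' : Obj} {m : Pro a b} {m' : Pro a' b'}
    (φ : TotalPro.of m ⟶ TotalPro.of m') :
    compMap (unitMap (srcMap φ)) φ (tgtMap_unitMap _) ≫ (leftUnitor m').hom =
      (leftUnitor m).hom ≫ φ
  /-- right unitor -/
  rightUnitor {a b : Obj} (m : Pro a b) : TotalPro.of (comp m (unit b)) ≅ TotalPro.of m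
  srcMap_rightUnitor {a b : Obj} (m : Pro a b) : srcMap (rightUnitor m).hom = 𝟙 a
  tgtMap_rightUnitor {a b : Obj} (m : Pro a b) : tgtMap (rightUnitor m).hom = 𝟙 b
  rightUnitor_naturality {a b a' b' : Obj} {m : Pro a b} {m' : Pro a' b'}
    (φ : TotalPro.of m ⟶ TotalPro.of m') :
    compMap φ (unitMap (tgtMap φ)) (srcMap_unitMap _).symm ≫ (rightUnitor m').hom =
      (rightUnitor m).hom ≫ φ
  pentagon {a b c d e : Obj} (m : Pro a b) (n : Pro b c) (p : Pro c d) (q : Pro d e) :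
    compMap (assoc m n p).hom (𝟙 (TotalPro.of q))
        ((tgtMap_assoc m n p).trans (srcMap_id (TotalPro.of q)).symm) ≫
      (assoc m (comp n p) q).hom ≫
        compMap (𝟙 (TotalPro.of m)) (assoc n p q).hom
          ((tgtMap_id (TotalPro.of m)).trans (srcMap_assoc n p q).symm) =
      (assoc (comp m n) p q).hom ≫ (assoc m n (comp p q)).hom
  triangle {a b c : Obj} (m : Pro a b) (n : Pro b c) :
    (assoc m (unit b) n).hom ≫
        compMap (𝟙 (TotalPro.of m)) (leftUnitor n).hom
          ((tgtMap_id (TotalPro.of m)).trans (srcMap_leftUnitor n).symm) =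
      compMap (rightUnitor m).hom (𝟙 (TotalPro.of n))
        ((tgtMap_rightUnitor m).trans (srcMap_id (TotalPro.of n)).symm)

namespace DoubleCategory

attribute [instance] DoubleCategory.category₀ DoubleCategory.category₁

/-- The type of proarrows of `D`, which are the objects of the category `D₁` of proarrows and
cells. -/
abbrev Total (D : DoubleCategory.{u₀, v₀, u₁, v₁}) : Type (max u₀ u₁) := TotalPro D.Pro

/-- The source functor `D₁ ⥤ D₀`. -/
def srcFunctor (D : DoubleCategory.{u₀, v₀, u₁, v₁}) : D.Total ⥤ D.Obj where
  obj M := M.src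
  map φ := D.srcMap φ
  map_id := D.srcMap_id
  map_comp := D.srcMap_comp

/-- The target functor `D₁ ⥤ D₀`. -/
def tgtFunctor (D : DoubleCategory.{u₀, v₀, u₁, v₁}) : D.Total ⥤ D.Obj where
  obj M := M.tgt
  map φ := D.tgtMap φ
  map_id := D.tgtMap_id
  map_comp := D.tgtMap_comp

/-! ### Cocartesian double categories -/

/-- A choice of finite coproducts in `D₀` and `D₁` that is strictly compatible with source and
target, so that `m + m' : x + x' ⇸ y + y'` for `m : x ⇸ y` and `m' : x' ⇸ y'`. -/
structure CoproductChoice (D : DoubleCategory.{u₀, v₀, u₁, v₁}) where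
  zero : D.Obj
  zeroIsInitial : IsInitial zero
  sum : D.Obj → D.Obj → D.Obj
  inl (a b : D.Obj) : a ⟶ sum a b
  inr (a b : D.Obj) : b ⟶ sum a b
  isColimit (a b : D.Obj) : IsColimit (BinaryCofan.mk (inl a b) (inr a b))
  zeroPro : D.Pro zero zero
  zeroProIsInitial : IsInitial (TotalPro.of zeroPro)
  sumPro {a b a' b' : D.Obj} (m : D.Pro a b) (m' : D.Pro a' b') : D.Pro (sum a a') (sum b b')
  inlPro {a b a' b' : D.Obj} (m : D.Pro a b) (m' : D.Pro a' b') :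
    TotalPro.of m ⟶ TotalPro.of (sumPro m m')
  inrPro {a b a' b' : D.Obj} (m : D.Pro a b) (m' : D.Pro a' b') :
    TotalPro.of m' ⟶ TotalPro.of (sumPro m m')
  srcMap_inlPro {a b a' b' : D.Obj} (m : D.Pro a b) (m' : D.Pro a' b') :
    D.srcMap (inlPro m m') = inl a a'
  srcMap_inrPro {a b a' b' : D.Obj} (m : D.Pro a b) (m' : D.Pro a' b') :
    D.srcMap (inrPro m m') = inr a a'
  tgtMap_inlPro {a b a' b' : D.Obj} (m : D.Pro a b) (m' : D.Pro a' b') :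
    D.tgtMap (inlPro m m') = inl b b'
  tgtMap_inrPro {a b a' b' : D.Obj} (m : D.Pro a b) (m' : D.Pro a' b') :
    D.tgtMap (inrPro m m') = inr b b'
  isColimitPro {a b a' b' : D.Obj} (m : D.Pro a b) (m' : D.Pro a' b') :
    IsColimit (BinaryCofan.mk (inlPro m m') (inrPro m m'))

namespace CoproductChoice

variable {D : DoubleCategory.{u₀, v₀, u₁, v₁}} (c : D.CoproductChoice)

/-- The comparison cell `(m ⊙ n) + (m' ⊙ n') ⟶ (m + m') ⊙ (n + n')`. -/
def compComparison {x y z x' y' z' : D.Obj} (m : D.Pro x y) (n : D.Pro y z)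
    (m' : D.Pro x' y') (n' : D.Pro y' z') :
    TotalPro.of (c.sumPro (D.comp m n) (D.comp m' n')) ⟶
      TotalPro.of (D.comp (c.sumPro m m') (c.sumPro n n')) :=
  (c.isColimitPro (D.comp m n) (D.comp m' n')).desc
    (BinaryCofan.mk
      (D.compMap (c.inlPro m m') (c.inlPro n n')
        ((c.tgtMap_inlPro m m').trans (c.srcMap_inlPro n n').symm))
      (D.compMap (c.inrPro m m') (c.inrPro n n')
        ((c.tgtMap_inrPro m m').trans (c.srcMap_inrPro n n').symm)))

/-- The comparison cell `id_x + id_x' ⟶ id_{x + x'}`. -/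
def unitComparison (x x' : D.Obj) :
    TotalPro.of (c.sumPro (D.unit x) (D.unit x')) ⟶ TotalPro.of (D.unit (c.sum x x')) :=
  (c.isColimitPro (D.unit x) (D.unit x')).desc
    (BinaryCofan.mk (D.unitMap (c.inl x x')) (D.unitMap (c.inr x x')))

/-- The comparison cell `0 ⟶ 0 ⊙ 0`. -/
def compComparisonZero : TotalPro.of c.zeroPro ⟶ TotalPro.of (D.comp c.zeroPro c.zeroPro) :=
  c.zeroProIsInitial.to _

/-- The comparison cell `0 ⟶ id_0`. -/
def unitComparisonZero : TotalPro.of c.zeroPro ⟶ TotalPro.of (D.unit c.zero) :=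
  c.zeroProIsInitial.to _

/-- All comparison cells interchanging finite coproducts with external composition and units are
isomorphisms. -/
structure ComparisonsIso : Prop where
  comp {x y z x' y' z' : D.Obj} (m : D.Pro x y) (n : D.Pro y z)
    (m' : D.Pro x' y') (n' : D.Pro y' z') : IsIso (c.compComparison m n m' n')
  unit (x x' : D.Obj) : IsIso (c.unitComparison x x')
  comp_zero : IsIso c.compComparisonZero
  unit_zero : IsIso c.unitComparisonZero

end CoproductChoice

/-- A double category is cocartesian if `D₀` and `D₁` have finite coproducts, these are preserved
by source and target, and they are preserved by external composition and units in the sense that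
the canonical comparison cells are isomorphisms. The comparison cells are formed with respect to
coproducts that are strictly compatible with source and target, which is what makes
`(m + m') ⊙ (n + n')` meaningful. -/
structure IsCocartesian (D : DoubleCategory.{u₀, v₀, u₁, v₁}) : Prop where
  hasFiniteCoproducts₀ : HasFiniteCoproducts D.Obj
  hasFiniteCoproducts₁ : HasFiniteCoproducts D.Total
  preserves_src : PreservesFiniteCoproducts D.srcFunctor
  preserves_tgt : PreservesFiniteCoproducts D.tgtFunctor
  exists_comparisonsIso : ∃ c : D.CoproductChoice, c.ComparisonsIso

end DoubleCategory

/-! ### Lax double functors -/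

/-- The action of a double functor on objects, arrows, proarrows and cells: a functor `D₀ ⥤ E₀` and
a functor `D₁ ⥤ E₁` that commute strictly with source and target. -/
structure DoubleGraphHom (D : DoubleCategory.{u₀, v₀, u₁, v₁})
    (E : DoubleCategory.{u₀', v₀', u₁', v₁'}) where
  functor₀ : D.Obj ⥤ E.Obj
  mapPro {a b : D.Obj} (m : D.Pro a b) : E.Pro (functor₀.obj a) (functor₀.obj b)
  mapCell {a b c d : D.Obj} {m : D.Pro a b} {n : D.Pro c d}
    (φ : TotalPro.of m ⟶ TotalPro.of n) : TotalPro.of (mapPro m) ⟶ TotalPro.of (mapPro n)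
  srcMap_mapCell {a b c d : D.Obj} {m : D.Pro a b} {n : D.Pro c d}
    (φ : TotalPro.of m ⟶ TotalPro.of n) : E.srcMap (mapCell φ) = functor₀.map (D.srcMap φ)
  tgtMap_mapCell {a b c d : D.Obj} {m : D.Pro a b} {n : D.Pro c d}
    (φ : TotalPro.of m ⟶ TotalPro.of n) : E.tgtMap (mapCell φ) = functor₀.map (D.tgtMap φ)
  mapCell_id {a b : D.Obj} (m : D.Pro a b) :
    mapCell (𝟙 (TotalPro.of m)) = 𝟙 (TotalPro.of (mapPro m))
  mapCell_comp {a b c d e f : D.Obj} {m : D.Pro a b} {n : D.Pro c d} {p : D.Pro e f}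
    (φ : TotalPro.of m ⟶ TotalPro.of n) (ψ : TotalPro.of n ⟶ TotalPro.of p) :
    mapCell (φ ≫ ψ) = mapCell φ ≫ mapCell ψ

namespace DoubleGraphHom

/-- The underlying functor `D₁ ⥤ E₁`. -/
def functor₁ {D : DoubleCategory.{u₀, v₀, u₁, v₁}} {E : DoubleCategory.{u₀', v₀', u₁', v₁'}}
    (F : DoubleGraphHom D E) : D.Total ⥤ E.Total where
  obj M := TotalPro.of (F.mapPro M.pro)
  map φ := F.mapCell φ
  map_id M := F.mapCell_id M.pro
  map_comp φ ψ := F.mapCell_comp φ ψ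

theorem mapCell_match {D : DoubleCategory.{u₀, v₀, u₁, v₁}}
    {E : DoubleCategory.{u₀', v₀', u₁', v₁'}} (F : DoubleGraphHom D E)
    {a b c a' b' c' : D.Obj} {m : D.Pro a b} {n : D.Pro b c} {m' : D.Pro a' b'}
    {n' : D.Pro b' c'} (φ : TotalPro.of m ⟶ TotalPro.of m') (ψ : TotalPro.of n ⟶ TotalPro.of n')
    (h : D.tgtMap φ = D.srcMap ψ) : E.tgtMap (F.mapCell φ) = E.srcMap (F.mapCell ψ) := by
  rw [F.tgtMap_mapCell, F.srcMap_mapCell, h]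

end DoubleGraphHom

/-- Laxators `F m ⊙ F n ⟶ F (m ⊙ n)` and unitors `id_{F a} ⟶ F id_a` making `F` a lax double
functor: they are globular, natural, and satisfy the associativity and unit coherence laws. -/
structure LaxStructure {D : DoubleCategory.{u₀, v₀, u₁, v₁}}
    {E : DoubleCategory.{u₀', v₀', u₁', v₁'}} (F : DoubleGraphHom D E) where
  laxator {a b c : D.Obj} (m : D.Pro a b) (n : D.Pro b c) :
    TotalPro.of (E.comp (F.mapPro m) (F.mapPro n)) ⟶ TotalPro.of (F.mapPro (D.comp m n))
  srcMap_laxator {a b c : D.Obj} (m : D.Pro a b) (n : D.Pro b c) :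
    E.srcMap (laxator m n) = 𝟙 (F.functor₀.obj a)
  tgtMap_laxator {a b c : D.Obj} (m : D.Pro a b) (n : D.Pro b c) :
    E.tgtMap (laxator m n) = 𝟙 (F.functor₀.obj c)
  laxator_naturality {a b c a' b' c' : D.Obj} {m : D.Pro a b} {n : D.Pro b c} {m' : D.Pro a' b'}
    {n' : D.Pro b' c'} (φ : TotalPro.of m ⟶ TotalPro.of m') (ψ : TotalPro.of n ⟶ TotalPro.of n')
    (h : D.tgtMap φ = D.srcMap ψ) :
    E.compMap (F.mapCell φ) (F.mapCell ψ) (F.mapCell_match φ ψ h) ≫ laxator m' n' =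
      laxator m n ≫ F.mapCell (D.compMap φ ψ h)
  unitor (a : D.Obj) :
    TotalPro.of (E.unit (F.functor₀.obj a)) ⟶ TotalPro.of (F.mapPro (D.unit a))
  srcMap_unitor (a : D.Obj) : E.srcMap (unitor a) = 𝟙 (F.functor₀.obj a)
  tgtMap_unitor (a : D.Obj) : E.tgtMap (unitor a) = 𝟙 (F.functor₀.obj a)
  unitor_naturality {a b : D.Obj} (f : a ⟶ b) :
    E.unitMap (F.functor₀.map f) ≫ unitor b = unitor a ≫ F.mapCell (D.unitMap f)
  associativity {a b c d : D.Obj} (m : D.Pro a b) (n : D.Pro b c) (p : D.Pro c d) :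
    E.compMap (laxator m n) (𝟙 (TotalPro.of (F.mapPro p)))
        ((tgtMap_laxator m n).trans (E.srcMap_id (TotalPro.of (F.mapPro p))).symm) ≫
      laxator (D.comp m n) p ≫ F.mapCell (D.assoc m n p).hom =
    (E.assoc (F.mapPro m) (F.mapPro n) (F.mapPro p)).hom ≫
      E.compMap (𝟙 (TotalPro.of (F.mapPro m))) (laxator n p)
        ((E.tgtMap_id (TotalPro.of (F.mapPro m))).trans (srcMap_laxator n p).symm) ≫
      laxator m (D.comp n p)
  left_unitality {a b : D.Obj} (m : D.Pro a b) :
    E.compMap (unitor a) (𝟙 (TotalPro.of (F.mapPro m)))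
        ((tgtMap_unitor a).trans (E.srcMap_id (TotalPro.of (F.mapPro m))).symm) ≫
      laxator (D.unit a) m ≫ F.mapCell (D.leftUnitor m).hom =
    (E.leftUnitor (F.mapPro m)).hom
  right_unitality {a b : D.Obj} (m : D.Pro a b) :
    E.compMap (𝟙 (TotalPro.of (F.mapPro m))) (unitor b)
        ((E.tgtMap_id (TotalPro.of (F.mapPro m))).trans (srcMap_unitor b).symm) ≫
      laxator m (D.unit b) ≫ F.mapCell (D.rightUnitor m).hom =
    (E.rightUnitor (F.mapPro m)).hom

/-- A lax double functor. -/
structure LaxDoubleFunctor (D : DoubleCategory.{u₀, v₀, u₁, v₁})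
    (E : DoubleCategory.{u₀', v₀', u₁', v₁'}) where
  toGraphHom : DoubleGraphHom D E
  lax : LaxStructure toGraphHom

namespace LaxDoubleFunctor

variable {D : DoubleCategory.{u₀, v₀, u₁, v₁}} {E : DoubleCategory.{u₀', v₀', u₁', v₁'}}

/-- A lax double functor is pseudo if its laxators and unitors are isomorphisms. -/
structure IsPseudo (F : LaxDoubleFunctor D E) : Prop where
  isIso_laxator {a b c : D.Obj} (m : D.Pro a b) (n : D.Pro b c) : IsIso (F.lax.laxator m n)
  isIso_unitor (a : D.Obj) : IsIso (F.lax.unitor a)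

/-- A lax double functor (between cocartesian double categories) is cocartesian if both underlying
functors `F₀ : D₀ ⥤ E₀` and `F₁ : D₁ ⥤ E₁` preserve finite coproducts. -/
structure IsCocartesian (F : LaxDoubleFunctor D E) : Prop where
  preserves₀ : PreservesFiniteCoproducts F.toGraphHom.functor₀
  preserves₁ : PreservesFiniteCoproducts F.toGraphHom.functor₁

end LaxDoubleFunctor

/-! ### Structured cospans -/

section StructuredCospans

variable {A : Type uA} [Category.{vA} A] {X : Type uX} [Category.{vX} X]

/-- An `L`-structured cospan `L a ⟶ x ⟵ L b` with feet `a` and `b`. -/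
structure StructuredCospan (L : A ⥤ X) (a b : A) where
  apex : X
  left : L.obj a ⟶ apex
  right : L.obj b ⟶ apex

namespace StructuredCospan

variable {L : A ⥤ X}

/-- A morphism of structured cospans, consisting of two foot maps in `A` and an apex map in `X`. -/
@[ext]
structure Hom (M N : TotalPro (StructuredCospan L)) where
  src : M.src ⟶ N.src
  tgt : M.tgt ⟶ N.tgt
  apex : M.pro.apex ⟶ N.pro.apex
  left_comm : M.pro.left ≫ apex = L.map src ≫ N.pro.left
  right_comm : M.pro.right ≫ apex = L.map tgt ≫ N.pro.right

instance : Category (TotalPro (StructuredCospan L)) where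
  Hom M N := Hom M N
  id M := ⟨𝟙 _, 𝟙 _, 𝟙 _, by simp, by simp⟩
  comp φ ψ := ⟨φ.src ≫ ψ.src, φ.tgt ≫ ψ.tgt, φ.apex ≫ ψ.apex,
    by rw [← Category.assoc, φ.left_comm, Category.assoc, ψ.left_comm, L.map_comp, Category.assoc],
    by rw [← Category.assoc, φ.right_comm, Category.assoc, ψ.right_comm, L.map_comp,
      Category.assoc]⟩
  id_comp φ := Hom.ext (Category.id_comp _) (Category.id_comp _) (Category.id_comp _)
  comp_id φ := Hom.ext (Category.comp_id _) (Category.comp_id _) (Category.comp_id _)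
  assoc φ ψ χ := Hom.ext (Category.assoc _ _ _) (Category.assoc _ _ _) (Category.assoc _ _ _)

@[ext]
theorem hom_ext {M N : TotalPro (StructuredCospan L)} {φ ψ : M ⟶ N} (h₁ : φ.src = ψ.src)
    (h₂ : φ.tgt = ψ.tgt) (h₃ : φ.apex = ψ.apex) : φ = ψ :=
  Hom.ext h₁ h₂ h₃

@[simp] theorem id_src (M : TotalPro (StructuredCospan L)) : Hom.src (𝟙 M) = 𝟙 M.src := rfl
@[simp] theorem id_tgt (M : TotalPro (StructuredCospan L)) : Hom.tgt (𝟙 M) = 𝟙 M.tgt := rfl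
@[simp] theorem id_apex (M : TotalPro (StructuredCospan L)) : Hom.apex (𝟙 M) = 𝟙 M.pro.apex := rfl
@[simp] theorem comp_src {M N P : TotalPro (StructuredCospan L)} (φ : M ⟶ N) (ψ : N ⟶ P) :
    Hom.src (φ ≫ ψ) = φ.src ≫ ψ.src := rfl
@[simp] theorem comp_tgt {M N P : TotalPro (StructuredCospan L)} (φ : M ⟶ N) (ψ : N ⟶ P) :
    Hom.tgt (φ ≫ ψ) = φ.tgt ≫ ψ.tgt := rfl
@[simp] theorem comp_apex {M N P : TotalPro (StructuredCospan L)} (φ : M ⟶ N) (ψ : N ⟶ P) :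
    Hom.apex (φ ≫ ψ) = φ.apex ≫ ψ.apex := rfl

/-- A globular isomorphism of structured cospans, given by an isomorphism of apexes. -/
@[simps]
def globularIso {a b : A} {m n : StructuredCospan L a b} (e : m.apex ≅ n.apex)
    (hl : m.left ≫ e.hom = n.left) (hr : m.right ≫ e.hom = n.right) :
    TotalPro.of m ≅ TotalPro.of n where
  hom := ⟨𝟙 a, 𝟙 b, e.hom, by simp [hl], by simp [hr]⟩
  inv := ⟨𝟙 a, 𝟙 b, e.inv, by simp [← hl], by simp [← hr]⟩
  hom_inv_id := by ext <;> simp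
  inv_hom_id := by ext <;> simp

/-- The cospan `L a = L a = L a`. -/
abbrev unit (L : A ⥤ X) (a : A) : StructuredCospan L a a := ⟨L.obj a, 𝟙 _, 𝟙 _⟩

/-- The external unit on arrows. -/
@[simps]
def unitMap (L : A ⥤ X) {a b : A} (f : a ⟶ b) :
    TotalPro.of (unit L a) ⟶ TotalPro.of (unit L b) where
  src := f
  tgt := f
  apex := L.map f
  left_comm := by simp
  right_comm := by simp

attribute [local simp] pushout.inl_desc pushout.inl_desc_assoc pushout.inr_desc pushout.inr_desc_assoc

section

variable [HasPushouts X]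

theorem pushout_desc_unit_left {u u' x x' : X} {l : u ⟶ x} {l' : u' ⟶ x'} {k : u ⟶ u'} (h : x ⟶ x')
    (w : l ≫ h = k ≫ l') :
    pushout.desc (f := 𝟙 u) (g := l) (k ≫ pushout.inl (𝟙 u') l') (h ≫ pushout.inr (𝟙 u') l')
        (by rw [reassoc_of% w, ← pushout.condition]; simp) ≫
      pushout.desc l' (𝟙 x') (by simp) = pushout.desc l (𝟙 x) (by simp) ≫ h := by
  apply pushout.hom_ext <;> simp [w]

theorem pushout_desc_unit_right {u u' x x' : X} {r : u ⟶ x} {r' : u' ⟶ x'} {k : u ⟶ u'} (h : x ⟶ x')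
    (w : r ≫ h = k ≫ r') :
    pushout.desc (f := r) (g := 𝟙 u) (h ≫ pushout.inl r' (𝟙 u')) (k ≫ pushout.inr r' (𝟙 u'))
        (by rw [reassoc_of% w, pushout.condition]; simp) ≫
      pushout.desc (𝟙 x') r' (by simp) = pushout.desc (𝟙 x) r (by simp) ≫ h := by
  apply pushout.hom_ext <;> simp [w]

/-- External composition of structured cospans, by pushout. -/
noncomputable abbrev comp {a b c : A} (m : StructuredCospan L a b) (n : StructuredCospan L b c) :
    StructuredCospan L a c where
  apex := pushout m.right n.left
  left := m.left ≫ pushout.inl m.right n.left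
  right := n.right ≫ pushout.inr m.right n.left

/-- External composition of morphisms of structured cospans, induced on pushouts. -/
@[simps]
noncomputable def compMap {a b c a' b' c' : A} {m : StructuredCospan L a b}
    {n : StructuredCospan L b c} {m' : StructuredCospan L a' b'} {n' : StructuredCospan L b' c'}
    (φ : TotalPro.of m ⟶ TotalPro.of m') (ψ : TotalPro.of n ⟶ TotalPro.of n')
    (h : φ.tgt = ψ.src) : TotalPro.of (comp m n) ⟶ TotalPro.of (comp m' n') where
  src := φ.src
  tgt := ψ.tgt
  apex := pushout.desc (φ.apex ≫ pushout.inl _ _) (ψ.apex ≫ pushout.inr _ _) (by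
    have h₁ := φ.right_comm
    have h₂ := ψ.left_comm
    dsimp at h₁ h₂ h
    rw [reassoc_of% h₁, reassoc_of% h₂, h, pushout.condition])
  left_comm := by
    have h₁ := φ.left_comm
    dsimp at h₁ ⊢
    rw [Category.assoc, pushout.inl_desc, reassoc_of% h₁]
  right_comm := by
    have h₂ := ψ.right_comm
    dsimp at h₂ ⊢
    rw [Category.assoc, pushout.inr_desc, reassoc_of% h₂]

end

/-- The double category of `L`-structured cospans, for a functor `L : A ⥤ X` into a category with
pushouts. -/
noncomputable abbrev _root_.SCsp (L : A ⥤ X) [HasPushouts X] :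
    DoubleCategory.{uA, vA, max uX vX, max vA vX} where
  Obj := A
  Pro a b := StructuredCospan L a b
  srcMap φ := Hom.src φ
  srcMap_id _ := rfl
  srcMap_comp _ _ := rfl
  tgtMap φ := Hom.tgt φ
  tgtMap_id _ := rfl
  tgtMap_comp _ _ := rfl
  comp m n := StructuredCospan.comp m n
  compMap φ ψ h := StructuredCospan.compMap φ ψ h
  srcMap_compMap _ _ _ := rfl
  tgtMap_compMap _ _ _ := rfl
  compMap_id m n := by
    refine hom_ext ?_ ?_ ?_
    · simp
    · simp
    · apply pushout.hom_ext <;> simp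
  compMap_comp φ ψ h φ' ψ' h' := by
    refine hom_ext ?_ ?_ ?_
    · simp
    · simp
    · apply pushout.hom_ext <;> simp
  unit a := StructuredCospan.unit L a
  unitMap f := StructuredCospan.unitMap L f
  srcMap_unitMap _ := rfl
  tgtMap_unitMap _ := rfl
  unitMap_id a := by ext <;> simp
  unitMap_comp f g := by ext <;> simp
  assoc m n p := globularIso (pushoutAssoc m.right n.left n.right p.left) (by simp) (by simp)
  srcMap_assoc _ _ _ := rfl
  tgtMap_assoc _ _ _ := rfl
  assoc_naturality φ ψ χ h k := by
    refine hom_ext ?_ ?_ ?_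
    · simp
    · simp
    · apply pushout.hom_ext
      · apply pushout.hom_ext <;> simp
      · simp
  leftUnitor m := globularIso
    ⟨pushout.desc m.left (𝟙 _) (by simp), pushout.inr _ _,
      by apply pushout.hom_ext <;> simp [← pushout.condition], by simp⟩ (by simp) (by simp)
  srcMap_leftUnitor _ := rfl
  tgtMap_leftUnitor _ := rfl
  leftUnitor_naturality {a b a' b' m m'} φ := by
    refine hom_ext ((Category.comp_id _).trans (Category.id_comp _).symm)
      ((Category.comp_id _).trans (Category.id_comp _).symm) ?_
    exact pushout_desc_unit_left φ.apex φ.left_comm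
  rightUnitor m := globularIso
    ⟨pushout.desc (𝟙 _) m.right (by simp), pushout.inl _ _,
      by apply pushout.hom_ext <;> simp [pushout.condition], by simp⟩ (by simp) (by simp)
  srcMap_rightUnitor _ := rfl
  tgtMap_rightUnitor _ := rfl
  rightUnitor_naturality {a b a' b' m m'} φ := by
    refine hom_ext ((Category.comp_id _).trans (Category.id_comp _).symm)
      ((Category.comp_id _).trans (Category.id_comp _).symm) ?_
    exact pushout_desc_unit_right φ.apex φ.right_comm
  pentagon m n p q := by
    refine hom_ext ?_ ?_ ?_
    · simp
    · simp
    · apply pushout.hom_ext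
      · apply pushout.hom_ext
        · apply pushout.hom_ext <;> simp
        · simp
      · simp
  triangle m n := by
    refine hom_ext ?_ ?_ ?_
    · simp
    · simp
    · apply pushout.hom_ext
      · apply pushout.hom_ext
        · simp
        · simp [pushout.condition]
      · simp

end StructuredCospan

variable {A' : Type uA'} [Category.{vA'} A'] {X' : Type uX'} [Category.{vX'} X']

/-- The image `L' F₀ a ⟶ F₁ L a ⟶ F₁ x ⟵ F₁ L b ⟵ L' F₀ b` of `L a ⟶ x ⟵ L b` under functors `F₀`,
`F₁` and a natural transformation `α : L' F₀ ⟶ F₁ L`. -/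
abbrev StructuredCospan.map {L : A ⥤ X} {L' : A' ⥤ X'} (F₀ : A ⥤ A') (F₁ : X ⥤ X')
    (α : F₀ ⋙ L' ⟶ L ⋙ F₁) {a b : A} (m : StructuredCospan L a b) :
    StructuredCospan L' (F₀.obj a) (F₀.obj b) where
  apex := F₁.obj m.apex
  left := α.app a ≫ F₁.map m.left
  right := α.app b ≫ F₁.map m.right

/-- The image `(F₀ f, F₀ g, F₁ h)` of a morphism `(f, g, h)` of structured cospans. -/
@[simps]
def StructuredCospan.mapHom {L : A ⥤ X} {L' : A' ⥤ X'} (F₀ : A ⥤ A') (F₁ : X ⥤ X')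
    (α : F₀ ⋙ L' ⟶ L ⋙ F₁) {a b c d : A} {m : StructuredCospan L a b} {n : StructuredCospan L c d}
    (φ : TotalPro.of m ⟶ TotalPro.of n) :
    TotalPro.of (StructuredCospan.map F₀ F₁ α m) ⟶ TotalPro.of (StructuredCospan.map F₀ F₁ α n) where
  src := F₀.map φ.src
  tgt := F₀.map φ.tgt
  apex := F₁.map φ.apex
  left_comm := by
    have h₁ := φ.left_comm
    have h₂ := α.naturality φ.src
    dsimp [StructuredCospan.map] at h₁ h₂ ⊢
    rw [Category.assoc, ← F₁.map_comp, h₁, F₁.map_comp, reassoc_of% h₂]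
  right_comm := by
    have h₁ := φ.right_comm
    have h₂ := α.naturality φ.tgt
    dsimp [StructuredCospan.map] at h₁ h₂ ⊢
    rw [Category.assoc, ← F₁.map_comp, h₁, F₁.map_comp, reassoc_of% h₂]

/-- The action on objects, arrows, proarrows and cells of double categories of structured cospans
induced by functors `F₀`, `F₁` and a natural transformation `α : L' F₀ ⟶ F₁ L`. -/
noncomputable abbrev SCsp.mapGraph [HasPushouts X] [HasPushouts X'] {L : A ⥤ X} {L' : A' ⥤ X'}
    (F₀ : A ⥤ A') (F₁ : X ⥤ X') (α : F₀ ⋙ L' ⟶ L ⋙ F₁) :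
    DoubleGraphHom (SCsp L) (SCsp L') where
  functor₀ := F₀
  mapPro m := StructuredCospan.map F₀ F₁ α m
  mapCell φ := StructuredCospan.mapHom F₀ F₁ α φ
  srcMap_mapCell _ := rfl
  tgtMap_mapCell _ := rfl
  mapCell_id _ := StructuredCospan.Hom.ext (F₀.map_id _) (F₀.map_id _) (F₁.map_id _)
  mapCell_comp _ _ := StructuredCospan.Hom.ext (F₀.map_comp _ _) (F₀.map_comp _ _)
    (F₁.map_comp _ _)

end StructuredCospans

/-!
Every construction on structured cospans splits into its source, target and apex components.

For the lax structure, the laxator and the unitor are globular with apex maps given by the universal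
property of the pushout and by `α`; each coherence law is an equation between morphisms out of an
iterated pushout and is checked on coprojections (`mapLax`). If `F₁` preserves pushouts and `α` is
invertible, the span defining the apex of `F m ⊙ F n` is isomorphic to the image of the span
defining that of `m ⊙ n`, so the laxator is invertible (`isIso_mapLaxator`).

For coproducts, a cocone of structured cospans whose three components are colimits is itself a
colimit as soon as `L` preserves the colimits of feet, because a morphism out of `L (colim a)` is
then determined by its restrictions (`isColimitOfComponents`). Hence finite coproducts of structured
cospans are componentwise, source and target preserve them, and `F` preserves them on proarrows when
`F₀` and `F₁` do. The comparison cells are invertible because pushouts commute with coproducts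
(`isColimitPushoutCofan`) and `L` preserves coproducts (`comparisonsIso_coproductChoice`).

Conversely, `F₁` is the composite of the functor `x ↦ (L 0 ⟶ x ⟵ L 0)`, the action of `F` on
proarrows, and the apex functor. The first is left adjoint to the apex functor because `0` and `L 0`
are initial, and the last preserves finite coproducts; so `F₁` preserves finite coproducts whenever
`F` does on proarrows (`preservesFiniteCoproducts_of_functor₁`).
-/

universe uJ vJ

namespace StructuredCospan

variable {A : Type uA} [Category.{vA} A] {X : Type uX} [Category.{vX} X]
  {A' : Type uA'} [Category.{vA'} A'] {X' : Type uX'} [Category.{vX'} X']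

attribute [local simp] pushout.inl_desc pushout.inl_desc_assoc pushout.inr_desc
  pushout.inr_desc_assoc

/-! ### The lax structure -/

section Lax

variable {L : A ⥤ X}

/-- The componentwise inverse is compatible with the legs because the cell is. -/
theorem isIso_of_components {M N : TotalPro (StructuredCospan L)} (φ : M ⟶ N)
    [IsIso φ.src] [IsIso φ.tgt] [IsIso φ.apex] : IsIso φ := by
  refine ⟨⟨inv φ.src, inv φ.tgt, inv φ.apex, ?_, ?_⟩, ?_, ?_⟩
  · rw [IsIso.comp_inv_eq, Category.assoc, φ.left_comm, ← L.map_comp_assoc]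
    simp
  · rw [IsIso.comp_inv_eq, Category.assoc, φ.right_comm, ← L.map_comp_assoc]
    simp
  · ext <;> exact IsIso.hom_inv_id _
  · ext <;> exact IsIso.inv_hom_id _

variable {L' : A' ⥤ X'} (F₀ : A ⥤ A') (F₁ : X ⥤ X') (α : F₀ ⋙ L' ⟶ L ⋙ F₁)

/-- The cell `id_{F a} ⟶ F id_a`, whose apex map is the component of `α` at `a`. -/
@[simps]
def mapUnitor (a : A) :
    TotalPro.of (unit L' (F₀.obj a)) ⟶ TotalPro.of ((unit L a).map F₀ F₁ α) where
  src := 𝟙 _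
  tgt := 𝟙 _
  apex := α.app a
  left_comm := by simp
  right_comm := by simp

theorem isIso_mapUnitor [IsIso α] (a : A) : IsIso (mapUnitor F₀ F₁ α a) := by
  have : IsIso (mapUnitor F₀ F₁ α a).src := inferInstanceAs (IsIso (𝟙 _))
  have : IsIso (mapUnitor F₀ F₁ α a).tgt := inferInstanceAs (IsIso (𝟙 _))
  have : IsIso (mapUnitor F₀ F₁ α a).apex := inferInstanceAs (IsIso (α.app a))
  exact isIso_of_components _

variable [HasPushouts X] [HasPushouts X']

/-- The cell `F m ⊙ F n ⟶ F (m ⊙ n)` induced on apexes by the pushout property. -/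
@[simps]
noncomputable def mapLaxator {a b c : A} (m : StructuredCospan L a b)
    (n : StructuredCospan L b c) :
    TotalPro.of (comp (m.map F₀ F₁ α) (n.map F₀ F₁ α)) ⟶
      TotalPro.of ((comp m n).map F₀ F₁ α) where
  src := 𝟙 _
  tgt := 𝟙 _
  apex := pushout.desc (F₁.map (pushout.inl _ _)) (F₁.map (pushout.inr _ _)) (by
    simp only [Category.assoc, ← F₁.map_comp, pushout.condition])
  left_comm := by simp
  right_comm := by simp

/-- The lax structure on the double functor induced by `F₀`, `F₁` and `α`. -/
noncomputable def mapLax : LaxStructure (SCsp.mapGraph F₀ F₁ α) where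
  laxator m n := mapLaxator F₀ F₁ α m n
  srcMap_laxator _ _ := rfl
  tgtMap_laxator _ _ := rfl
  laxator_naturality φ ψ h := by
    refine hom_ext (by simp) (by simp) ?_
    apply pushout.hom_ext <;> simp [← Functor.map_comp]
  unitor a := mapUnitor F₀ F₁ α a
  srcMap_unitor _ := rfl
  tgtMap_unitor _ := rfl
  unitor_naturality f := by
    refine hom_ext (by simp) (by simp) ?_
    exact α.naturality f
  associativity m n p := by
    refine hom_ext (by simp) (by simp) ?_
    apply pushout.hom_ext
    · apply pushout.hom_ext <;> simp [← Functor.map_comp]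
    · simp [← Functor.map_comp]
  left_unitality m := by
    refine hom_ext (by simp) (by simp) ?_
    apply pushout.hom_ext <;> simp [← Functor.map_comp]
  right_unitality m := by
    refine hom_ext (by simp) (by simp) ?_
    apply pushout.hom_ext <;> simp [← Functor.map_comp]

/-- The apexes of `F m ⊙ F n` and of `F (m ⊙ n)` are pushouts of spans that differ only by the
isomorphism `α_b`. -/
theorem isIso_mapLaxator [PreservesColimitsOfShape WalkingSpan F₁] [IsIso α] {a b c : A}
    (m : StructuredCospan L a b) (n : StructuredCospan L b c) :
    IsIso (mapLaxator F₀ F₁ α m n) := by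
  have h : IsPushout (α.app b ≫ F₁.map m.right) (α.app b ≫ F₁.map n.left)
      (F₁.map (pushout.inl m.right n.left)) (F₁.map (pushout.inr m.right n.left)) :=
    ((IsPushout.of_hasPushout m.right n.left).map F₁).of_iso (asIso (α.app b)).symm (Iso.refl _)
      (Iso.refl _) (Iso.refl _) (by simp) (by simp) (by simp) (by simp)
  have : IsIso (mapLaxator F₀ F₁ α m n).src := inferInstanceAs (IsIso (𝟙 _))
  have : IsIso (mapLaxator F₀ F₁ α m n).tgt := inferInstanceAs (IsIso (𝟙 _))
  have : IsIso (mapLaxator F₀ F₁ α m n).apex := by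
    have e : (mapLaxator F₀ F₁ α m n).apex = h.isoPushout.inv := by
      apply pushout.hom_ext <;> simp
    rw [e]
    infer_instance
  exact isIso_of_components _

end Lax

/-! ### Colimits of structured cospans -/

section Colimits

/-- The functor sending a structured cospan to its source. -/
abbrev srcFunctor (L : A ⥤ X) : TotalPro (StructuredCospan L) ⥤ A where
  obj M := M.src
  map φ := φ.src

/-- The functor sending a structured cospan to its target. -/
abbrev tgtFunctor (L : A ⥤ X) : TotalPro (StructuredCospan L) ⥤ A where
  obj M := M.tgt
  map φ := φ.tgt

/-- The functor sending a structured cospan to its apex. -/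
abbrev apexFunctor (L : A ⥤ X) : TotalPro (StructuredCospan L) ⥤ X where
  obj M := M.pro.apex
  map φ := φ.apex

variable {L : A ⥤ X} {J : Type uJ} [Category.{vJ} J]

/-- A cocone of structured cospans is a colimit if its three components are, provided that `L`
preserves the colimits of feet: compatibility of the induced cell with the legs is an equation
between morphisms out of `L` of such a colimit, and so may be checked on coprojections. -/
def isColimitOfComponents {K : J ⥤ TotalPro (StructuredCospan L)} (c : Cocone K)
    (hs : IsColimit ((srcFunctor L).mapCocone c)) (ht : IsColimit ((tgtFunctor L).mapCocone c))
    (ha : IsColimit ((apexFunctor L).mapCocone c))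
    (hLs : IsColimit (L.mapCocone ((srcFunctor L).mapCocone c)))
    (hLt : IsColimit (L.mapCocone ((tgtFunctor L).mapCocone c))) : IsColimit c where
  desc s :=
    { src := hs.desc ((srcFunctor L).mapCocone s)
      tgt := ht.desc ((tgtFunctor L).mapCocone s)
      apex := ha.desc ((apexFunctor L).mapCocone s)
      left_comm := hLs.hom_ext fun j => by
        have h₁ := (c.ι.app j).left_comm
        have h₂ := (s.ι.app j).left_comm
        have h₃ := ha.fac ((apexFunctor L).mapCocone s) j
        have h₄ := hs.fac ((srcFunctor L).mapCocone s) j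
        dsimp at h₁ h₂ h₃ h₄ ⊢
        rw [← reassoc_of% h₁, h₃, h₂, ← L.map_comp_assoc, h₄]
      right_comm := hLt.hom_ext fun j => by
        have h₁ := (c.ι.app j).right_comm
        have h₂ := (s.ι.app j).right_comm
        have h₃ := ha.fac ((apexFunctor L).mapCocone s) j
        have h₄ := ht.fac ((tgtFunctor L).mapCocone s) j
        dsimp at h₁ h₂ h₃ h₄ ⊢
        rw [← reassoc_of% h₁, h₃, h₂, ← L.map_comp_assoc, h₄] }
  fac s j := hom_ext (hs.fac ((srcFunctor L).mapCocone s) j)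
    (ht.fac ((tgtFunctor L).mapCocone s) j) (ha.fac ((apexFunctor L).mapCocone s) j)
  uniq s m hm := hom_ext
    (hs.uniq ((srcFunctor L).mapCocone s) _ fun j => congrArg Hom.src (hm j))
    (ht.uniq ((tgtFunctor L).mapCocone s) _ fun j => congrArg Hom.tgt (hm j))
    (ha.uniq ((apexFunctor L).mapCocone s) _ fun j => congrArg Hom.apex (hm j))

section

variable [HasColimitsOfShape J A] [HasColimitsOfShape J X] [PreservesColimitsOfShape J L]
  (K : J ⥤ TotalPro (StructuredCospan L))

/-- The left legs of a diagram of structured cospans, as a cocone on the images under `L` of the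
sources. -/
noncomputable abbrev leftCocone : Cocone ((K ⋙ srcFunctor L) ⋙ L) where
  pt := colimit (K ⋙ apexFunctor L)
  ι :=
    { app := fun j => (K.obj j).pro.left ≫ colimit.ι (K ⋙ apexFunctor L) j
      naturality := fun i j f => by
        have h := (K.map f).left_comm
        have h' := colimit.w (K ⋙ apexFunctor L) f
        dsimp at h h' ⊢
        rw [← reassoc_of% h, h', Category.comp_id] }

/-- The right legs of a diagram of structured cospans, as a cocone on the images under `L` of the
targets. -/
noncomputable abbrev rightCocone : Cocone ((K ⋙ tgtFunctor L) ⋙ L) where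
  pt := colimit (K ⋙ apexFunctor L)
  ι :=
    { app := fun j => (K.obj j).pro.right ≫ colimit.ι (K ⋙ apexFunctor L) j
      naturality := fun i j f => by
        have h := (K.map f).right_comm
        have h' := colimit.w (K ⋙ apexFunctor L) f
        dsimp at h h' ⊢
        rw [← reassoc_of% h, h', Category.comp_id] }

/-- The cocone of structured cospans whose components are the colimits of sources, targets and
apexes. -/
noncomputable def colimitCocone : Cocone K where
  pt := ⟨colimit (K ⋙ srcFunctor L), colimit (K ⋙ tgtFunctor L),
    { apex := colimit (K ⋙ apexFunctor L)
      left := (isColimitOfPreserves L (colimit.isColimit (K ⋙ srcFunctor L))).desc (leftCocone K)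
      right :=
        (isColimitOfPreserves L (colimit.isColimit (K ⋙ tgtFunctor L))).desc (rightCocone K) }⟩
  ι :=
    { app := fun j =>
        { src := colimit.ι (K ⋙ srcFunctor L) j
          tgt := colimit.ι (K ⋙ tgtFunctor L) j
          apex := colimit.ι (K ⋙ apexFunctor L) j
          left_comm := ((isColimitOfPreserves L
            (colimit.isColimit (K ⋙ srcFunctor L))).fac (leftCocone K) j).symm
          right_comm := ((isColimitOfPreserves L
            (colimit.isColimit (K ⋙ tgtFunctor L))).fac (rightCocone K) j).symm }
      naturality := fun _ _ f => hom_ext ((colimit.cocone (K ⋙ srcFunctor L)).ι.naturality f)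
        ((colimit.cocone (K ⋙ tgtFunctor L)).ι.naturality f)
        ((colimit.cocone (K ⋙ apexFunctor L)).ι.naturality f) }

/-- The source component of `colimitCocone` is a colimit. -/
noncomputable def isColimitSrc : IsColimit ((srcFunctor L).mapCocone (colimitCocone K)) :=
  colimit.isColimit (K ⋙ srcFunctor L)

/-- The target component of `colimitCocone` is a colimit. -/
noncomputable def isColimitTgt : IsColimit ((tgtFunctor L).mapCocone (colimitCocone K)) :=
  colimit.isColimit (K ⋙ tgtFunctor L)

/-- The apex component of `colimitCocone` is a colimit. -/
noncomputable def isColimitApex : IsColimit ((apexFunctor L).mapCocone (colimitCocone K)) :=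
  colimit.isColimit (K ⋙ apexFunctor L)

/-- Colimits of structured cospans are formed componentwise. -/
noncomputable def isColimitColimitCocone : IsColimit (colimitCocone K) :=
  isColimitOfComponents _ (isColimitSrc K) (isColimitTgt K) (isColimitApex K)
    (isColimitOfPreserves L (isColimitSrc K)) (isColimitOfPreserves L (isColimitTgt K))

end

section

variable (L J) [HasColimitsOfShape J A] [HasColimitsOfShape J X] [PreservesColimitsOfShape J L]

theorem hasColimitsOfShape : HasColimitsOfShape J (TotalPro (StructuredCospan L)) where
  has_colimit K := ⟨⟨⟨colimitCocone K, isColimitColimitCocone K⟩⟩⟩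

theorem preservesColimitsOfShape_srcFunctor : PreservesColimitsOfShape J (srcFunctor L) where
  preservesColimit {K} :=
    preservesColimit_of_preserves_colimit_cocone (isColimitColimitCocone K) (isColimitSrc K)

theorem preservesColimitsOfShape_tgtFunctor : PreservesColimitsOfShape J (tgtFunctor L) where
  preservesColimit {K} :=
    preservesColimit_of_preserves_colimit_cocone (isColimitColimitCocone K) (isColimitTgt K)

theorem preservesColimitsOfShape_apexFunctor : PreservesColimitsOfShape J (apexFunctor L) where
  preservesColimit {K} :=
    preservesColimit_of_preserves_colimit_cocone (isColimitColimitCocone K) (isColimitApex K)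

end

/-! ### Preservation of finite coproducts by the induced functor on proarrows -/

section Preservation

variable [HasPushouts X] [HasPushouts X'] {L' : A' ⥤ X'} (F₀ : A ⥤ A') (F₁ : X ⥤ X')
  (α : F₀ ⋙ L' ⟶ L ⋙ F₁)

theorem preservesColimitsOfShape_functor₁ [HasColimitsOfShape J A] [HasColimitsOfShape J X]
    [PreservesColimitsOfShape J L] [PreservesColimitsOfShape J L']
    [PreservesColimitsOfShape J F₀] [PreservesColimitsOfShape J F₁] :
    PreservesColimitsOfShape J (SCsp.mapGraph F₀ F₁ α).functor₁ where
  preservesColimit {K} := by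
    refine preservesColimit_of_preserves_colimit_cocone (isColimitColimitCocone K) ?_
    -- The components of the image cocone are the images of the components under `F₀` and `F₁`.
    have hs : IsColimit ((srcFunctor L').mapCocone
        ((SCsp.mapGraph F₀ F₁ α).functor₁.mapCocone (colimitCocone K))) :=
      isColimitOfPreserves F₀ (isColimitSrc K)
    have ht : IsColimit ((tgtFunctor L').mapCocone
        ((SCsp.mapGraph F₀ F₁ α).functor₁.mapCocone (colimitCocone K))) :=
      isColimitOfPreserves F₀ (isColimitTgt K)
    have ha : IsColimit ((apexFunctor L').mapCocone
        ((SCsp.mapGraph F₀ F₁ α).functor₁.mapCocone (colimitCocone K))) :=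
      isColimitOfPreserves F₁ (isColimitApex K)
    exact isColimitOfComponents _ hs ht ha (isColimitOfPreserves L' hs)
      (isColimitOfPreserves L' ht)

/-- The functor sending `x` to the cospan `L z ⟶ x ⟵ L z`, for an object `z` of `A` such that `L z`
is initial. -/
@[simps]
def initialFeet {z : A} (hLz : IsInitial (L.obj z)) : X ⥤ TotalPro (StructuredCospan L) where
  obj x := TotalPro.of ⟨x, hLz.to x, hLz.to x⟩
  map h := ⟨𝟙 z, 𝟙 z, h, hLz.hom_ext _ _, hLz.hom_ext _ _⟩
  map_id _ := rfl
  map_comp _ _ := hom_ext (Category.comp_id _).symm (Category.comp_id _).symm rfl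

/-- A cell out of a cospan with initial feet is the same as a morphism of apexes. -/
def initialFeetAdjunction {z : A} (hz : IsInitial z) (hLz : IsInitial (L.obj z)) :
    initialFeet hLz ⊣ apexFunctor L :=
  Adjunction.mkOfHomEquiv
    { homEquiv := fun _ _ =>
        { toFun := fun φ => φ.apex
          invFun := fun h => ⟨hz.to _, hz.to _, h, hLz.hom_ext _ _, hLz.hom_ext _ _⟩
          left_inv := fun _ => hom_ext (hz.hom_ext _ _) (hz.hom_ext _ _) rfl
          right_inv := fun _ => rfl }
      homEquiv_naturality_left_symm := fun _ _ =>
        hom_ext (hz.hom_ext _ _) (hz.hom_ext _ _) rfl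
      homEquiv_naturality_right := fun _ _ => rfl }

/-- `F₁` is recovered from the functor on proarrows by restricting to cospans with initial feet and
taking apexes; both of these operations preserve finite coproducts. -/
theorem preservesFiniteCoproducts_of_functor₁ [HasInitial A] [PreservesFiniteCoproducts L]
    [HasFiniteCoproducts A'] [HasFiniteCoproducts X'] [PreservesFiniteCoproducts L']
    (h : PreservesFiniteCoproducts (SCsp.mapGraph F₀ F₁ α).functor₁) :
    PreservesFiniteCoproducts F₁ where
  preserves n := by
    have hz : IsInitial (⊥_ A) := initialIsInitial
    have hLz : IsInitial (L.obj (⊥_ A)) := hz.isInitialObj L _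
    have h₁ : PreservesColimitsOfSize.{0, 0} (initialFeet hLz) :=
      (initialFeetAdjunction hz hLz).leftAdjoint_preservesColimits
    have h₂ := h.preserves n
    have h₃ := preservesColimitsOfShape_apexFunctor L' (Discrete (Fin n))
    have : PreservesColimitsOfShape (Discrete (Fin n))
        ((initialFeet hLz ⋙ (SCsp.mapGraph F₀ F₁ α).functor₁) ⋙ apexFunctor L') :=
      comp_preservesColimitsOfShape _ _
    exact this

end Preservation

end Colimits

/-! ### Cocartesianness of structured cospans -/

section Cocartesian

variable {L : A ⥤ X}

/-- The binary case of `isColimitOfComponents`. -/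
noncomputable def isColimitBinaryCofanOfComponents
    [PreservesColimitsOfShape (Discrete WalkingPair) L]
    {M N P : TotalPro (StructuredCospan L)} (φ : M ⟶ P) (ψ : N ⟶ P)
    (hs : IsColimit (BinaryCofan.mk φ.src ψ.src)) (ht : IsColimit (BinaryCofan.mk φ.tgt ψ.tgt))
    (ha : IsColimit (BinaryCofan.mk φ.apex ψ.apex)) : IsColimit (BinaryCofan.mk φ ψ) :=
  let hs' := (isColimitMapCoconeBinaryCofanEquiv (srcFunctor L) φ ψ).symm hs
  let ht' := (isColimitMapCoconeBinaryCofanEquiv (tgtFunctor L) φ ψ).symm ht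
  isColimitOfComponents _ hs' ht'
    ((isColimitMapCoconeBinaryCofanEquiv (apexFunctor L) φ ψ).symm ha)
    (isColimitOfPreserves L hs') (isColimitOfPreserves L ht')

/-- The nullary case of `isColimitOfComponents`. -/
def isInitialOfComponents [PreservesColimit (Functor.empty.{0} A) L]
    {M : TotalPro (StructuredCospan L)} (hs : IsInitial M.src) (ht : IsInitial M.tgt)
    (ha : IsInitial M.pro.apex) : IsInitial M :=
  IsInitial.ofUniqueHom
    (fun _ => ⟨hs.to _, ht.to _, ha.to _, (hs.isInitialObj L _).hom_ext _ _,
      (ht.isInitialObj L _).hom_ext _ _⟩)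
    (fun _ _ => hom_ext (hs.hom_ext _ _) (ht.hom_ext _ _) (ha.hom_ext _ _))

attribute [local simp] coprod.inl_desc coprod.inl_desc_assoc coprod.inr_desc coprod.inr_desc_assoc

/-- Coproducts commute with pushouts: the pushout of a coproduct `x + x' ⟵ u + u' ⟶ y + y'` of two
spans is a coproduct of their pushouts. -/
noncomputable def isColimitPushoutCofan [HasBinaryCoproducts X] [HasPushouts X]
    {u u' v x x' y y' : X} {i : u ⟶ v} {i' : u' ⟶ v} (hv : IsColimit (BinaryCofan.mk i i'))
    {f : u ⟶ x} {g : u ⟶ y} {f' : u' ⟶ x'} {g' : u' ⟶ y'} {p : v ⟶ x ⨿ x'} {q : v ⟶ y ⨿ y'}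
    (hp : i ≫ p = f ≫ coprod.inl) (hp' : i' ≫ p = f' ≫ coprod.inr)
    (hq : i ≫ q = g ≫ coprod.inl) (hq' : i' ≫ q = g' ≫ coprod.inr) :
    IsColimit (BinaryCofan.mk
      (pushout.desc (f := f) (g := g) (coprod.inl ≫ pushout.inl p q) (coprod.inl ≫ pushout.inr p q)
        (by rw [← reassoc_of% hp, ← reassoc_of% hq, pushout.condition]))
      (pushout.desc (f := f') (g := g') (coprod.inr ≫ pushout.inl p q)
        (coprod.inr ≫ pushout.inr p q)
        (by rw [← reassoc_of% hp', ← reassoc_of% hq', pushout.condition]))) :=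
  have w {z : X} (k : pushout f g ⟶ z) (k' : pushout f' g' ⟶ z) :
      p ≫ coprod.desc (pushout.inl f g ≫ k) (pushout.inl f' g' ≫ k') =
        q ≫ coprod.desc (pushout.inr f g ≫ k) (pushout.inr f' g' ≫ k') := by
    have h₁ : i ≫ p ≫ coprod.desc (pushout.inl f g ≫ k) (pushout.inl f' g' ≫ k') =
        i ≫ q ≫ coprod.desc (pushout.inr f g ≫ k) (pushout.inr f' g' ≫ k') := by
      simp [reassoc_of% hp, reassoc_of% hq, pushout.condition_assoc]
    have h₂ : i' ≫ p ≫ coprod.desc (pushout.inl f g ≫ k) (pushout.inl f' g' ≫ k') =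
        i' ≫ q ≫ coprod.desc (pushout.inr f g ≫ k) (pushout.inr f' g' ≫ k') := by
      simp [reassoc_of% hp', reassoc_of% hq', pushout.condition_assoc]
    exact BinaryCofan.IsColimit.hom_ext hv h₁ h₂
  BinaryCofan.IsColimit.mk _
    (fun k k' => pushout.desc _ _ (w k k'))
    (fun k k' => show pushout.desc _ _ _ ≫ pushout.desc _ _ (w k k') = k by
      apply pushout.hom_ext <;> simp)
    (fun k k' => show pushout.desc _ _ _ ≫ pushout.desc _ _ (w k k') = k' by
      apply pushout.hom_ext <;> simp)
    (fun k k' (l : pushout p q ⟶ _) h₁ h₂ => by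
      change pushout.desc _ _ _ ≫ l = _ at h₁ h₂
      change l = pushout.desc _ _ (w k k')
      apply pushout.hom_ext <;> apply coprod.hom_ext <;> simp [← h₁, ← h₂])

section

variable [HasBinaryCoproducts A] [HasBinaryCoproducts X]
  [PreservesColimitsOfShape (Discrete WalkingPair) L]

/-- The leg `L (a + b) ≅ L a + L b ⟶ x + y` determined by legs `L a ⟶ x` and `L b ⟶ y`. -/
noncomputable def sumLeg {a b : A} {x y : X} (f : L.obj a ⟶ x) (g : L.obj b ⟶ y) :
    L.obj (a ⨿ b) ⟶ x ⨿ y :=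
  (isColimitOfHasBinaryCoproductOfPreservesColimit L a b).desc
    (BinaryCofan.mk (f ≫ coprod.inl) (g ≫ coprod.inr))

@[simp]
theorem inl_sumLeg {a b : A} {x y : X} (f : L.obj a ⟶ x) (g : L.obj b ⟶ y) :
    L.map coprod.inl ≫ sumLeg f g = f ≫ coprod.inl :=
  (isColimitOfHasBinaryCoproductOfPreservesColimit L a b).fac _ ⟨.left⟩

@[simp]
theorem inr_sumLeg {a b : A} {x y : X} (f : L.obj a ⟶ x) (g : L.obj b ⟶ y) :
    L.map coprod.inr ≫ sumLeg f g = g ≫ coprod.inr :=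
  (isColimitOfHasBinaryCoproductOfPreservesColimit L a b).fac _ ⟨.right⟩

/-- The coproduct of two structured cospans. -/
noncomputable abbrev sum {a b a' b' : A} (m : StructuredCospan L a b)
    (m' : StructuredCospan L a' b') : StructuredCospan L (a ⨿ a') (b ⨿ b') where
  apex := m.apex ⨿ m'.apex
  left := sumLeg m.left m'.left
  right := sumLeg m.right m'.right

/-- The first coprojection into a coproduct of structured cospans. -/
@[simps]
noncomputable def sumInl {a b a' b' : A} (m : StructuredCospan L a b)
    (m' : StructuredCospan L a' b') : TotalPro.of m ⟶ TotalPro.of (sum m m') where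
  src := coprod.inl
  tgt := coprod.inl
  apex := coprod.inl
  left_comm := by simp
  right_comm := by simp

/-- The second coprojection into a coproduct of structured cospans. -/
@[simps]
noncomputable def sumInr {a b a' b' : A} (m : StructuredCospan L a b)
    (m' : StructuredCospan L a' b') : TotalPro.of m' ⟶ TotalPro.of (sum m m') where
  src := coprod.inr
  tgt := coprod.inr
  apex := coprod.inr
  left_comm := by simp
  right_comm := by simp

end

section

variable (L) [HasFiniteCoproducts A] [HasFiniteCoproducts X] [PreservesFiniteCoproducts L]
  [HasPushouts X]

/-- The choice of finite coproducts of structured cospans whose components are the chosen finite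
coproducts of `A` and `X`. -/
noncomputable def coproductChoice : (SCsp L).CoproductChoice where
  zero := ⊥_ A
  zeroIsInitial := initialIsInitial
  sum a b := a ⨿ b
  inl _ _ := coprod.inl
  inr _ _ := coprod.inr
  isColimit a b := coprodIsCoprod a b
  zeroPro := ⟨⊥_ X, (initialIsInitial.isInitialObj L _).to _,
    (initialIsInitial.isInitialObj L _).to _⟩
  zeroProIsInitial := isInitialOfComponents initialIsInitial initialIsInitial initialIsInitial
  sumPro m m' := sum m m'
  inlPro m m' := sumInl m m'
  inrPro m m' := sumInr m m'
  srcMap_inlPro _ _ := rfl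
  srcMap_inrPro _ _ := rfl
  tgtMap_inlPro _ _ := rfl
  tgtMap_inrPro _ _ := rfl
  isColimitPro _ _ := isColimitBinaryCofanOfComponents _ _ (coprodIsCoprod _ _)
    (coprodIsCoprod _ _) (coprodIsCoprod _ _)

/-- Each comparison cell is the canonical map between two colimits of the same diagram. -/
theorem comparisonsIso_coproductChoice : (coproductChoice L).ComparisonsIso where
  comp m n m' n' :=
    ((coproductChoice L).isColimitPro _ _).nonempty_isColimit_iff_isIso_desc.mp
      ⟨isColimitBinaryCofanOfComponents _ _ (coprodIsCoprod _ _) (coprodIsCoprod _ _)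
        (isColimitPushoutCofan (isColimitOfHasBinaryCoproductOfPreservesColimit L _ _)
          (inl_sumLeg _ _) (inr_sumLeg _ _) (inl_sumLeg _ _) (inr_sumLeg _ _))⟩
  unit x x' :=
    ((coproductChoice L).isColimitPro _ _).nonempty_isColimit_iff_isIso_desc.mp
      ⟨isColimitBinaryCofanOfComponents _ _ (coprodIsCoprod _ _) (coprodIsCoprod _ _)
        (isColimitOfHasBinaryCoproductOfPreservesColimit L x x')⟩
  comp_zero := by
    have h : IsInitial (TotalPro.of
        ((SCsp L).comp (coproductChoice L).zeroPro (coproductChoice L).zeroPro)) :=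
      isInitialOfComponents initialIsInitial initialIsInitial
        (IsInitial.ofUniqueHom
          (fun _ => pushout.desc (initial.to _) (initial.to _)
            ((initialIsInitial.isInitialObj L _).hom_ext _ _))
          (fun _ _ => pushout.hom_ext (initialIsInitial.hom_ext _ _)
            (initialIsInitial.hom_ext _ _)))
    exact isIso_of_isInitial (coproductChoice L).zeroProIsInitial h _
  unit_zero := by
    have h : IsInitial (TotalPro.of ((SCsp L).unit (coproductChoice L).zero)) :=
      isInitialOfComponents initialIsInitial initialIsInitial
        (initialIsInitial.isInitialObj L _)
    exact isIso_of_isInitial (coproductChoice L).zeroProIsInitial h _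

theorem isCocartesian_SCsp : (SCsp L).IsCocartesian where
  hasFiniteCoproducts₀ := ‹_›
  hasFiniteCoproducts₁ := ⟨fun n => hasColimitsOfShape L (Discrete (Fin n))⟩
  preserves_src := ⟨fun n => preservesColimitsOfShape_srcFunctor L (Discrete (Fin n))⟩
  preserves_tgt := ⟨fun n => preservesColimitsOfShape_tgtFunctor L (Discrete (Fin n))⟩
  exists_comparisonsIso := ⟨coproductChoice L, comparisonsIso_coproductChoice L⟩

end

end Cocartesian

end StructuredCospan

/-! ### The double functor between structured cospans -/

theorem mainTheorem2 {A : Type uA} [Category.{vA} A] {X : Type uX} [Category.{vX} X]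
    {A' : Type uA'} [Category.{vA'} A'] {X' : Type uX'} [Category.{vX'} X']
    [HasPushouts X] [HasPushouts X']
    (L : A ⥤ X) (L' : A' ⥤ X') (F₀ : A ⥤ A') (F₁ : X ⥤ X') (α : F₀ ⋙ L' ⟶ L ⋙ F₁) :
    ∃ (lax : LaxStructure (SCsp.mapGraph F₀ F₁ α)) (F : LaxDoubleFunctor (SCsp L) (SCsp L')),
      F = ⟨SCsp.mapGraph F₀ F₁ α, lax⟩ ∧
      (∀ {a b c : A} (m : StructuredCospan L a b) (n : StructuredCospan L b c),
        pushout.inl (m.map F₀ F₁ α).right (n.map F₀ F₁ α).left ≫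
            StructuredCospan.Hom.apex (lax.laxator m n) = F₁.map (pushout.inl m.right n.left) ∧
        pushout.inr (m.map F₀ F₁ α).right (n.map F₀ F₁ α).left ≫
            StructuredCospan.Hom.apex (lax.laxator m n) = F₁.map (pushout.inr m.right n.left)) ∧
      (∀ a : A, StructuredCospan.Hom.apex (lax.unitor a) = α.app a) ∧
      (PreservesColimitsOfShape WalkingSpan F₁ → IsIso α → F.IsPseudo) ∧
      (HasFiniteCoproducts A → HasFiniteCoproducts X →
        HasFiniteCoproducts A' → HasFiniteCoproducts X' →
        PreservesFiniteCoproducts L → PreservesFiniteCoproducts L' →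
        (SCsp L).IsCocartesian ∧ (SCsp L').IsCocartesian ∧
        (F.IsCocartesian ↔ PreservesFiniteCoproducts F₀ ∧ PreservesFiniteCoproducts F₁) ∧
        (PreservesFiniteCoproducts F₀ → PreservesFiniteColimits F₁ → IsIso α →
          F.IsCocartesian ∧ F.IsPseudo)) := by
  have isPseudo : PreservesColimitsOfShape WalkingSpan F₁ → IsIso α →
      (⟨SCsp.mapGraph F₀ F₁ α, StructuredCospan.mapLax F₀ F₁ α⟩ :
        LaxDoubleFunctor (SCsp L) (SCsp L')).IsPseudo := fun _ _ =>
    ⟨StructuredCospan.isIso_mapLaxator F₀ F₁ α, StructuredCospan.isIso_mapUnitor F₀ F₁ α⟩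
  refine ⟨StructuredCospan.mapLax F₀ F₁ α, ⟨_, _⟩, rfl, fun m n => ?_, fun _ => rfl, isPseudo, ?_⟩
  · exact ⟨pushout.inl_desc _ _ _, pushout.inr_desc _ _ _⟩
  · intro _ _ _ _ _ _
    have isCocartesian : PreservesFiniteCoproducts F₀ → PreservesFiniteCoproducts F₁ →
        (⟨SCsp.mapGraph F₀ F₁ α, StructuredCospan.mapLax F₀ F₁ α⟩ :
          LaxDoubleFunctor (SCsp L) (SCsp L')).IsCocartesian := fun h _ =>
      ⟨h, ⟨fun _ => StructuredCospan.preservesColimitsOfShape_functor₁ F₀ F₁ α⟩⟩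
    refine ⟨StructuredCospan.isCocartesian_SCsp L, StructuredCospan.isCocartesian_SCsp L',
      ⟨fun h => ⟨h.preserves₀, ?_⟩, fun h => isCocartesian h.1 h.2⟩, fun h₀ h₁ hα => ?_⟩
    · exact StructuredCospan.preservesFiniteCoproducts_of_functor₁ F₀ F₁ α h.preserves₁
    · exact ⟨isCocartesian h₀ inferInstance, isPseudo inferInstance hα⟩
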